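/- Throughout, $\triangle_N\subset\mathbb R^N$ is the probability simplex and $\Omega:\triangle_N\to\mathbb R$ is a generalized negentropy: $\Omega(e_i)=0$ for every one-hot vector $e_i$, $\Omega$ is strictly convex, and $\Omega$ is invariant under permutations of the coordinates. Its Fenchel–Young loss is $L_\Omega(\theta,y)=\Omega(y)+\Omega^*(\theta)-\theta^\top y$ with $\Omega^*(\theta)=\sup_{y\in\triangle_N}(\theta^\top y-\Omega(y))$. We assume that $L_\Omega$ has margin $m\ge 0$, i.e. for all $\theta\in\mathbb R^N$ and all $i$, $L_\Omega(\theta,e_i)=0\iff\theta_i-\max_{j\ne i}\theta_j\ge m$. For $\beta>0$ and patterns $x_1,\dots,x_N\in\mathbb R^D$, the rows of $X\in\mathbb R^{N\times D}$, the Hopfield–Fenchel–Young (HFY) network iterates $q^{(t+1)}=X^\top\hat y_\Omega(\beta Xq^{(t)})$, where $\hat y_\Omega(\theta)=\operatorname{argmax}_{y\in\triangle_N}\theta^\top y-\Omega(y)$. It *stores and exactly retrieves the patterns in one iteration under an $\epsilon$-perturbation* if the patterns are distinct and, for every $i$ and every $q^{(0)}$ with $\|q^{(0)}-x_i\|\le\epsilon$,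 we have $q^{(T)}=x_i$ for all $T\ge1$. Let $M>0$ and let $D\ge 1$. **Proposition 3 (Storage capacity with exact retrieval).** 1. If the patterns lie on the sphere of radius $M$ about the origin with pairwise angles at least $\pi/3$, and $M^2>2m\beta^{-1}$ and $$\epsilon\le\frac M4-\frac{m}{2\beta M},$$ then the HFY network stores and exactly retrieves them in one iteration under an $\epsilon$-perturbation. The number of such patterns can be exponential in $D$: there is a universal constant $c>0$ such that for every $D\ge1$ and $M>0$ there exist $N\ge c\,(2/\sqrt3)^D$ points on the sphere of radius $M$ in $\mathbb R^D$ with pairwise angles at least $\pi/3$. 2. There is a universal constant $c>0$ such that the following holds for all $p\in[0,1]$ and $\zeta>0$. If the $N$ patterns are independent and uniformly distributed on the sphere of radius $M$, where $$N\le c\,\sqrt p\,\zeta^{\frac{D-1}2},\qquad \epsilon\le\frac M2\Bigl(1-\cos\frac1\zeta\Bigr)-\frac{m}{2\beta M},$$ then with probability at least $1-p$ the HFY network stores and exactly retrieves the patterns in one iteration under an $\epsilon$-perturbation. -/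

import Mathlib

open MeasureTheory ProbabilityTheory

noncomputable section

namespace HFY

/-- A generalized negentropy on the probability simplex `△_N`: zero at one-hot vectors, strictly
convex and permutation-invariant. A regularizer is a total function `(Fin N → ℝ) → ℝ` that is only
ever evaluated on the simplex, which is its domain (it stands for `Ω + I_{△_N}`). -/
structure IsGeneralizedNegentropy {N : ℕ} (Ω : (Fin N → ℝ) → ℝ) : Prop where
  zero_oneHot : ∀ i : Fin N, Ω (Pi.single i 1) = 0
  strictConvexOn : StrictConvexOn ℝ (stdSimplex ℝ (Fin N)) Ω
  perm_invariant : ∀ σ : Equiv.Perm (Fin N), ∀ y ∈ stdSimplex ℝ (Fin N), Ω (y ∘ σ) = Ω y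

/-- The Fenchel conjugate `Ω*(θ) = sup_{y ∈ △_N} θᵀy - Ω(y)`. A generalized negentropy is bounded
below by its value at the uniform distribution, so the supremum is that of a bounded set. -/
def fenchelConjugate {N : ℕ} (Ω : (Fin N → ℝ) → ℝ) (θ : Fin N → ℝ) : ℝ :=
  ⨆ y : stdSimplex ℝ (Fin N), (θ ⬝ᵥ y.1 - Ω y.1)

/-- The Fenchel-Young loss `L_Ω(θ, y) = Ω(y) + Ω*(θ) - θᵀy`. -/
def fenchelYoungLoss {N : ℕ} (Ω : (Fin N → ℝ) → ℝ) (θ y : Fin N → ℝ) : ℝ :=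
  Ω y + fenchelConjugate Ω θ - θ ⬝ᵥ y

/-- `L_Ω` has margin `m ≥ 0`: `L_Ω(θ, e_i) = 0 ↔ θ_i - max_{j ≠ i} θ_j ≥ m`.
For `N ≥ 2` at most one `m` satisfies this, so it is automatically the smallest one. -/
def HasMargin {N : ℕ} (Ω : (Fin N → ℝ) → ℝ) (m : ℝ) : Prop :=
  0 ≤ m ∧ ∀ (θ : Fin N → ℝ) (i : Fin N),
    fenchelYoungLoss Ω θ (Pi.single i 1) = 0 ↔ ∀ j, j ≠ i → m ≤ θ i - θ j

/-- `y` maximizes `θᵀy - Ω(y)` over the simplex. -/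
def IsRegArgmax {N : ℕ} (Ω : (Fin N → ℝ) → ℝ) (θ y : Fin N → ℝ) : Prop :=
  y ∈ stdSimplex ℝ (Fin N) ∧ IsMaxOn (fun z => θ ⬝ᵥ z - Ω z) (stdSimplex ℝ (Fin N)) y

/-- The `Ω`-regularized argmax transformation `ŷ_Ω(θ) = argmax_{y ∈ △_N} θᵀy - Ω(y)`. By strict
convexity there is at most one maximizer (the value is arbitrary where there is none). -/
def regArgmax {N : ℕ} (Ω : (Fin N → ℝ) → ℝ) (θ : Fin N → ℝ) : Fin N → ℝ :=
  Classical.epsilon (IsRegArgmax Ω θ)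

/-- The update `q ↦ Xᵀ ŷ_Ω(β X q)` of the Hopfield-Fenchel-Young network, where the rows of `X` are
the patterns `x i`. -/
def update {N D : ℕ} (Ω : (Fin N → ℝ) → ℝ) (β : ℝ) (x : Fin N → EuclideanSpace ℝ (Fin D))
    (q : EuclideanSpace ℝ (Fin D)) : EuclideanSpace ℝ (Fin D) :=
  ∑ i, regArgmax Ω (fun j => β * inner ℝ (x j) q) i • x i

/-- Pattern `x i` is exactly retrieved for the query `q` within `T` iterations:
`q^{(T')} = x i` for all `T' ≥ T`. -/
def RetrievedWithin {N D : ℕ} (Ω : (Fin N → ℝ) → ℝ) (β : ℝ)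
    (x : Fin N → EuclideanSpace ℝ (Fin D)) (q : EuclideanSpace ℝ (Fin D)) (i : Fin N)
    (T : ℕ) : Prop :=
  ∀ T' ≥ T, (update Ω β x)^[T'] q = x i

/-- The network stores the `N` (distinct) patterns `x` and exactly retrieves each of them in one
iteration under an `ε`-perturbation. -/
def StoresInOneIteration {N D : ℕ} (Ω : (Fin N → ℝ) → ℝ) (β ε : ℝ)
    (x : Fin N → EuclideanSpace ℝ (Fin D)) : Prop :=
  Function.Injective x ∧
    ∀ (i : Fin N) (q : EuclideanSpace ℝ (Fin D)), ‖q - x i‖ ≤ ε → RetrievedWithin Ω β x q i 1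

/-- The patterns lie on the sphere of radius `M` about the origin and are separated by an angle of
at least `α`. -/
def IsSeparatedOnSphere {N D : ℕ} (M α : ℝ) (x : Fin N → EuclideanSpace ℝ (Fin D)) : Prop :=
  (∀ i, ‖x i‖ = M) ∧ ∀ i j, i ≠ j → α ≤ InnerProductGeometry.angle (x i) (x j)

/-- The uniform distribution on the sphere of radius `M` about the origin of `ℝ^D`: the normalized
surface measure of the unit sphere, scaled by `M`. -/
def uniformSphere (D : ℕ) (M : ℝ) : Measure (EuclideanSpace ℝ (Fin D)) :=
  (((volume : Measure (EuclideanSpace ℝ (Fin D))).toSphere Set.univ)⁻¹ •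
      (volume : Measure (EuclideanSpace ℝ (Fin D))).toSphere).map
    (fun u : Metric.sphere (0 : EuclideanSpace ℝ (Fin D)) 1 => M • (u : EuclideanSpace ℝ (Fin D)))

end HFY

end

namespace HFY

/-! Retrieval is deterministic once cosines are bounded. By the margin, zero loss at `e_i` makes
`e_i` the unique regularized argmax, so one update lands exactly on `x i` as soon as its score beats
the others by `m`. If all pairwise cosines are at most `κ`, Cauchy–Schwarz bounds the loss caused by
a perturbation of size `ε` by `2 * M * ε`, and the condition on `ε` is what remains
(`storesInOneIteration_of_inner_le`). Part 1 takes `κ = cos (π/3)`, part 2 takes `κ = cos (1/ζ)`.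

Exponentially many separated points come from a greedy choice: too few caps of angle `π/3` leave
part of the sphere uncovered (`exists_unit_forall_inner_le`). For random points, a cap of angle
`1/ζ` has probability at most `2 * sin (1/ζ) ^ (D - 1)` (`volume_cone_le`, `uniformSphere_cap_le`),
and a union bound over pairs finishes. -/

/-! ### Regularized argmax and margin -/

/-- A generalized negentropy is bounded below by its value at the uniform distribution. -/
lemma IsGeneralizedNegentropy.uniform_le {n : ℕ} {Ω : (Fin (n + 1) → ℝ) → ℝ}
    (hΩ : IsGeneralizedNegentropy Ω) {y : Fin (n + 1) → ℝ} (hy : y ∈ stdSimplex ℝ (Fin (n + 1))) :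
    Ω (fun _ => ((n : ℝ) + 1)⁻¹) ≤ Ω y := by
  have hn : (0 : ℝ) < (n : ℝ) + 1 := by positivity
  have hmem : ∀ σ : Equiv.Perm (Fin (n + 1)), y ∘ σ ∈ stdSimplex ℝ (Fin (n + 1)) := fun σ =>
    ⟨fun i => hy.1 (σ i), by
      rw [← hy.2]; exact Equiv.sum_comp σ y⟩
  -- Jensen over the cyclic shifts of `y`: their average is uniform, and `Ω` agrees on all of them.
  have h := hΩ.strictConvexOn.convexOn.map_sum_le (t := Finset.univ)
    (w := fun _ : Fin (n + 1) => ((n : ℝ) + 1)⁻¹) (p := fun k => y ∘ Equiv.addLeft k)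
    (fun _ _ => by positivity) (by simp; field_simp) (fun k _ => hmem _)
  have h1 : ∑ k : Fin (n + 1), ((n : ℝ) + 1)⁻¹ • (y ∘ Equiv.addLeft k)
      = fun _ => ((n : ℝ) + 1)⁻¹ := by
    funext j
    have hs : ∑ k : Fin (n + 1), y (k + j) = 1 := by
      rw [← hy.2]; exact Equiv.sum_comp (Equiv.addRight j) y
    simp only [Finset.sum_apply, Pi.smul_apply, Function.comp_apply, Equiv.coe_addLeft,
      smul_eq_mul]
    rw [← Finset.mul_sum, hs, mul_one]
  rw [h1] at h
  refine h.trans_eq ?_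
  simp only [hΩ.perm_invariant _ y hy, smul_eq_mul, Finset.sum_const, Finset.card_univ,
    Fintype.card_fin, nsmul_eq_mul]
  push_cast
  field_simp

/-- Makes the real supremum in `fenchelConjugate` a genuine upper bound, rather than a junk value.
-/
lemma IsGeneralizedNegentropy.bddAbove {N : ℕ} {Ω : (Fin N → ℝ) → ℝ}
    (hΩ : IsGeneralizedNegentropy Ω) (θ : Fin N → ℝ) :
    BddAbove (Set.range fun y : stdSimplex ℝ (Fin N) => θ ⬝ᵥ y.1 - Ω y.1) := by
  cases N with
  | zero =>
    refine ⟨0, ?_⟩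
    rintro _ ⟨y, rfl⟩
    simpa using y.2.2
  | succ n =>
    refine ⟨∑ i, |θ i| - Ω (fun _ => ((n : ℝ) + 1)⁻¹), ?_⟩
    rintro _ ⟨y, rfl⟩
    refine sub_le_sub ?_ (hΩ.uniform_le y.2)
    refine Finset.sum_le_sum fun i _ => ?_
    have h0 : 0 ≤ y.1 i := y.2.1 i
    have h1 : y.1 i ≤ 1 := by
      rw [← y.2.2]
      exact Finset.single_le_sum (fun j _ => y.2.1 j) (Finset.mem_univ i)
    calc θ i * y.1 i ≤ |θ i| * y.1 i := mul_le_mul_of_nonneg_right (le_abs_self _) h0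
      _ ≤ |θ i| := mul_le_of_le_one_right (abs_nonneg _) h1

/-- Strict convexity makes the regularized argmax unique. -/
lemma IsGeneralizedNegentropy.isRegArgmax_unique {N : ℕ} {Ω : (Fin N → ℝ) → ℝ}
    (hΩ : IsGeneralizedNegentropy Ω) {θ y z : Fin N → ℝ}
    (hy : IsRegArgmax Ω θ y) (hz : IsRegArgmax Ω θ z) : y = z := by
  have hc : StrictConcaveOn ℝ (stdSimplex ℝ (Fin N)) (fun w => θ ⬝ᵥ w - Ω w) := by
    refine ⟨convex_stdSimplex ℝ _, fun a ha b hb hab s t hs ht hst => ?_⟩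
    have := hΩ.strictConvexOn.2 ha hb hab hs ht hst
    simp only [dotProduct_add, dotProduct_smul, smul_eq_mul] at this ⊢
    linarith
  exact hc.eq_of_isMaxOn hy.2 hz.2 hy.1 hz.1

/-- Beyond the margin, the regularized argmax is one-hot. -/
lemma regArgmax_eq_single {N : ℕ} {Ω : (Fin N → ℝ) → ℝ} {m : ℝ}
    (hΩ : IsGeneralizedNegentropy Ω) (hm : HasMargin Ω m) {θ : Fin N → ℝ} {i : Fin N}
    (hθ : ∀ j, j ≠ i → m ≤ θ i - θ j) : regArgmax Ω θ = Pi.single i 1 := by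
  have hL := (hm.2 θ i).2 hθ
  have hmax : IsRegArgmax Ω θ (Pi.single i 1) := by
    refine ⟨single_mem_stdSimplex ℝ i, fun z hz => ?_⟩
    -- Zero loss says that the supremum equals the objective at `e_i`.
    have h := le_ciSup (hΩ.bddAbove θ) ⟨z, hz⟩
    unfold fenchelYoungLoss fenchelConjugate at hL
    simp only [Set.mem_ofPred_eq] at h ⊢
    linarith
  exact hΩ.isRegArgmax_unique (Classical.epsilon_spec (p := IsRegArgmax Ω θ) ⟨_, hmax⟩) hmax

lemma update_eq_of_margin {N D : ℕ} {Ω : (Fin N → ℝ) → ℝ} {m β : ℝ}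
    (hΩ : IsGeneralizedNegentropy Ω) (hm : HasMargin Ω m)
    {x : Fin N → EuclideanSpace ℝ (Fin D)} {q : EuclideanSpace ℝ (Fin D)} {i : Fin N}
    (h : ∀ j, j ≠ i → m ≤ β * inner ℝ (x i) q - β * inner ℝ (x j) q) :
    update Ω β x q = x i := by
  unfold update
  rw [regArgmax_eq_single hΩ hm (i := i) h, Finset.sum_eq_single i]
  · simp
  · intro j _ hj
    simp [Pi.single_eq_of_ne hj]
  · simp

/-! ### Retrieval from bounded cosines -/

/-- Distinct patterns on a sphere whose pairwise cosines are at most `κ` are stored and exactly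
retrieved in one iteration. -/
lemma storesInOneIteration_of_inner_le {N D : ℕ} {Ω : (Fin N → ℝ) → ℝ} {M m β ε κ : ℝ}
    (hM : 0 < M) (hβ : 0 < β) (hΩ : IsGeneralizedNegentropy Ω) (hm : HasMargin Ω m)
    {x : Fin N → EuclideanSpace ℝ (Fin D)} (hx : Function.Injective x) (hnorm : ∀ i, ‖x i‖ = M)
    (hinner : ∀ i j, i ≠ j → inner ℝ (x i) (x j) ≤ M ^ 2 * κ)
    (hε : ε ≤ M / 2 * (1 - κ) - m / (2 * β * M)) : StoresInOneIteration Ω β ε x := by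
  have hstep : ∀ i q, ‖q - x i‖ ≤ ε → update Ω β x q = x i := by
    intro i q hq
    refine update_eq_of_margin hΩ hm fun j hj => ?_
    -- Isolates the perturbation `q - x i` in a single inner product.
    have h1 : inner ℝ (x i) q - inner ℝ (x j) q
        = inner ℝ (x i) (x i) - inner ℝ (x i) (x j) + inner ℝ (x i - x j) (q - x i) := by
      rw [inner_sub_left, inner_sub_right, inner_sub_right, real_inner_comm (x i) (x j)]
      ring
    have h2 : -(2 * M * ε) ≤ inner ℝ (x i - x j) (q - x i) := by
      have ha := abs_real_inner_le_norm (x i - x j) (q - x i)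
      have hb : ‖x i - x j‖ ≤ 2 * M := by
        have := norm_sub_le (x i) (x j)
        rw [hnorm, hnorm] at this
        linarith
      have hd : ‖x i - x j‖ * ‖q - x i‖ ≤ 2 * M * ε :=
        mul_le_mul hb hq (norm_nonneg _) (by positivity)
      linarith [neg_abs_le (inner ℝ (x i - x j) (q - x i))]
    have h3 := hinner i j hj.symm
    have h4 : inner ℝ (x i) (x i) = M ^ 2 := by rw [real_inner_self_eq_norm_sq, hnorm]
    have h5 : m ≤ β * (M ^ 2 - M ^ 2 * κ - 2 * M * ε) := by
      have h6 : 2 * β * M * ε ≤ 2 * β * M * (M / 2 * (1 - κ) - m / (2 * β * M)) :=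
        mul_le_mul_of_nonneg_left hε (by positivity)
      have h7 : 2 * β * M * (M / 2 * (1 - κ) - m / (2 * β * M)) = β * M ^ 2 * (1 - κ) - m := by
        field_simp
      linarith
    rw [← mul_sub, h1]
    exact h5.trans (mul_le_mul_of_nonneg_left (by linarith) hβ.le)
  refine ⟨hx, fun i q hq T hT => ?_⟩
  obtain ⟨t, rfl⟩ : ∃ t, T = t + 1 := ⟨T - 1, by omega⟩
  rw [Function.iterate_succ_apply, hstep i q hq]
  -- The existence of `q` forces `0 ≤ ε`, so `x i` is itself an admissible query, hence a fixed
  -- point.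
  exact Function.iterate_fixed
    (hstep i (x i) (by simpa using (norm_nonneg _).trans hq)) t

lemma IsSeparatedOnSphere.injective {N D : ℕ} {M α : ℝ} (hM : 0 < M) (hα : 0 < α)
    {x : Fin N → EuclideanSpace ℝ (Fin D)} (hx : IsSeparatedOnSphere M α x) :
    Function.Injective x := by
  intro i j hij
  by_contra hne
  have h := hx.2 i j hne
  have h0 : x j ≠ 0 := by rw [← norm_ne_zero_iff, hx.1]; exact hM.ne'
  rw [hij, InnerProductGeometry.angle_self h0] at h
  linarith

lemma IsSeparatedOnSphere.inner_le {N D : ℕ} {M α : ℝ} (hα : 0 ≤ α)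
    {x : Fin N → EuclideanSpace ℝ (Fin D)} (hx : IsSeparatedOnSphere M α x) {i j : Fin N}
    (hij : i ≠ j) : inner ℝ (x i) (x j) ≤ M ^ 2 * Real.cos α := by
  have h := Real.cos_le_cos_of_nonneg_of_le_pi hα (InnerProductGeometry.angle_le_pi _ _)
    (hx.2 i j hij)
  rw [← InnerProductGeometry.cos_angle_mul_norm_mul_norm, hx.1, hx.1]
  nlinarith [sq_nonneg M]

/-! ### Packing the sphere -/

/-- Fewer than `(2 / √3) ^ D` caps of angular radius `π / 3` do not cover the unit sphere. -/
lemma exists_unit_forall_inner_le {D n : ℕ} (hD : 1 ≤ D) (hn : (n : ℝ) < (2 / √3) ^ D)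
    (x : Fin n → EuclideanSpace ℝ (Fin D)) (hx : ∀ i, ‖x i‖ = 1) :
    ∃ u : EuclideanSpace ℝ (Fin D), ‖u‖ = 1 ∧ ∀ i, inner ℝ (x i) u ≤ 1 / 2 := by
  have : Nonempty (Fin D) := ⟨⟨0, hD⟩⟩
  have h3 : (√3 : ℝ) ^ 2 = 3 := Real.sq_sqrt (by norm_num)
  have hs3 : (0 : ℝ) < √3 := by positivity
  rcases Nat.eq_zero_or_pos n with rfl | hn0
  · obtain ⟨u, hu⟩ := exists_norm_eq (EuclideanSpace ℝ (Fin D)) zero_le_one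
    exact ⟨u, hu, fun i => i.elim0⟩
  by_contra! hcon
  -- If the caps covered the sphere, balls of radius `√3 / 2` about the midpoints `x i / 2` would
  -- cover the unit ball: membership of `y` reads `‖y‖² - ⟪x i, y⟫ ≤ 1/2`, which follows from `⟪x i,
  -- y⟫ > ‖y‖ / 2` and `‖y‖ ≤ 1`. Volumes then contradict `hn`.
  have hcover : Metric.closedBall (0 : EuclideanSpace ℝ (Fin D)) 1 ⊆
      ⋃ i, Metric.closedBall ((1 / 2 : ℝ) • x i) (√3 / 2) := by
    intro y hy
    rw [mem_closedBall_zero_iff] at hy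
    have key : ∀ i, ‖y‖ ^ 2 - inner ℝ (x i) y ≤ 1 / 2 →
        y ∈ ⋃ i, Metric.closedBall ((1 / 2 : ℝ) • x i) (√3 / 2) := by
      intro i hi
      refine Set.mem_iUnion.2 ⟨i, ?_⟩
      rw [mem_closedBall_iff_norm]
      refine abs_le_of_sq_le_sq' ?_ (by positivity) |>.2
      rw [norm_sub_sq_real, norm_smul, hx, inner_smul_right, real_inner_comm, div_pow, h3]
      norm_num
      linarith
    by_cases hy0 : y = 0
    · exact key ⟨0, hn0⟩ (by simp [hy0])
    · have hpos : 0 < ‖y‖ := norm_pos_iff.2 hy0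
      obtain ⟨i, hi⟩ := hcon (‖y‖⁻¹ • y) (by rw [norm_smul]; simp [hpos.ne'])
      refine key i ?_
      rw [inner_smul_right, ← div_eq_inv_mul, lt_div_iff₀ hpos] at hi
      nlinarith
  have hvol := (measure_mono hcover).trans (measure_iUnion_le (μ := volume) _)
  simp only [Measure.addHaar_closedBall' volume _ (show (0 : ℝ) ≤ √3 / 2 by positivity),
    finrank_euclideanSpace, Fintype.card_fin, tsum_fintype, Finset.sum_const, Finset.card_univ,
    nsmul_eq_mul] at hvol
  have hb0 : volume (Metric.closedBall (0 : EuclideanSpace ℝ (Fin D)) 1) ≠ 0 :=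
    (Metric.measure_closedBall_pos _ _ one_pos).ne'
  have hbt : volume (Metric.closedBall (0 : EuclideanSpace ℝ (Fin D)) 1) ≠ ⊤ :=
    measure_closedBall_lt_top.ne
  have hlt : (n : ENNReal) * ENNReal.ofReal ((√3 / 2) ^ D) < 1 := by
    rw [← ENNReal.ofReal_natCast, ← ENNReal.ofReal_mul (by positivity), ENNReal.ofReal_lt_one]
    calc (n : ℝ) * (√3 / 2) ^ D < (2 / √3) ^ D * (√3 / 2) ^ D := by gcongr
      _ = 1 := by rw [← mul_pow]; field_simp; simp
  rw [← mul_assoc] at hvol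
  have := ENNReal.mul_lt_mul_left hb0 hbt hlt
  rw [one_mul] at this
  exact absurd hvol (not_le.2 this)

/-- Greedy packing of the unit sphere. -/
lemma exists_unit_family_inner_le {D : ℕ} (hD : 1 ≤ D) :
    ∀ n : ℕ, (n : ℝ) < (2 / √3) ^ D + 1 → ∃ x : Fin n → EuclideanSpace ℝ (Fin D),
      (∀ i, ‖x i‖ = 1) ∧ ∀ i j, i ≠ j → inner ℝ (x i) (x j) ≤ 1 / 2
  | 0, _ => ⟨fun i => i.elim0, fun i => i.elim0, fun i => i.elim0⟩
  | n + 1, hn => by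
    have hn' : (n : ℝ) < (2 / √3) ^ D := by push_cast at hn; linarith
    obtain ⟨x, hx, hx'⟩ := exists_unit_family_inner_le hD n (by linarith)
    obtain ⟨u, hu, hu'⟩ := exists_unit_forall_inner_le hD hn' x hx
    refine ⟨Fin.cons u x, fun i => ?_, fun i j => ?_⟩
    · cases i using Fin.cases <;> simp [hu, hx]
    · cases i using Fin.cases <;> cases j using Fin.cases
      · simp
      · intro _
        simpa [real_inner_comm] using hu' _
      · intro _
        simpa using hu' _
      · intro h
        simpa using hx' _ _ (fun e => h (by rw [e]))

lemma exists_isSeparatedOnSphere {D : ℕ} (hD : 1 ≤ D) {M : ℝ} (hM : 0 < M) :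
    ∃ (N : ℕ) (x : Fin N → EuclideanSpace ℝ (Fin D)),
      (2 / √3) ^ D ≤ (N : ℝ) ∧ IsSeparatedOnSphere M (Real.pi / 3) x := by
  obtain ⟨x, hx, hx'⟩ := exists_unit_family_inner_le hD ⌈((2 : ℝ) / √3) ^ D⌉₊
    (Nat.ceil_lt_add_one (by positivity))
  refine ⟨_, fun i => M • x i, Nat.le_ceil _, fun i => ?_, fun i j hij => ?_⟩
  · rw [norm_smul, hx, Real.norm_of_nonneg hM.le, mul_one]
  · rw [InnerProductGeometry.angle_smul_smul hM.ne', InnerProductGeometry.angle, hx, hx,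
      ← Real.arccos_cos (x := Real.pi / 3) (by positivity) (by linarith [Real.pi_pos])]
    apply Real.arccos_le_arccos
    simpa [Real.cos_pi_div_three] using hx' i j hij

/-! ### Measure of spherical caps -/

/-- A cone of half-angle `arcsin s` inside the unit ball is covered by a ball of radius `s` and an
affine preimage of the unit ball. -/
lemma volume_cone_le {D : ℕ} (hD : 1 ≤ D) {e : EuclideanSpace ℝ (Fin D)} (he : ‖e‖ = 1)
    {s c : ℝ} (hs : 0 < s) (hc : 0 < c) (hsc : s ^ 2 + c ^ 2 = 1) :
    volume {x : EuclideanSpace ℝ (Fin D) | ‖x‖ ≤ 1 ∧ c * ‖x‖ ≤ inner ℝ e x} ≤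
      ENNReal.ofReal (2 * s ^ (D - 1)) * volume (Metric.ball (0 : EuclideanSpace ℝ (Fin D)) 1) := by
  set f : Module.Dual ℝ (EuclideanSpace ℝ (Fin D)) := (innerSL ℝ e).toLinearMap with hf
  -- `T` scales `e` by `-1/c` and its orthogonal complement by `1/s`. The preimage of the unit ball
  -- about `-e` is thus the ellipsoid centred at `c • e` with semi-axes `c` along `e` and `s`
  -- across; it contains the part of the cone with `⟪e, x⟫ ≤ c`.
  set T : EuclideanSpace ℝ (Fin D) →ₗ[ℝ] EuclideanSpace ℝ (Fin D) :=
    s⁻¹ • LinearMap.transvection f (-(s / c + 1) • e) with hT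
  have hee : inner ℝ e e = (1 : ℝ) := by rw [real_inner_self_eq_norm_sq, he, one_pow]
  have hTx : ∀ x, T x = s⁻¹ • (x + inner ℝ e x • (-(s / c + 1) • e)) := fun x => rfl
  have hdet : (LinearMap.det T)⁻¹ = -(c * s ^ (D - 1)) := by
    rw [hT, LinearMap.det_smul, LinearMap.transvection.det, finrank_euclideanSpace,
      Fintype.card_fin]
    have : f (-(s / c + 1) • e) = -(s / c + 1) := by
      rw [map_smul, smul_eq_mul]
      change _ * inner ℝ e e = _
      rw [hee, mul_one]
    rw [this]
    obtain ⟨d, rfl⟩ : ∃ d, D = d + 1 := ⟨D - 1, by omega⟩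
    simp only [Nat.add_sub_cancel]
    have : 1 + -(s / c + 1) = -(s / c) := by ring
    rw [this, inv_pow]
    field_simp
    ring
  have hdet0 : LinearMap.det T ≠ 0 := by
    intro h
    have : 0 < c * s ^ (D - 1) := by positivity
    rw [h, inv_zero] at hdet
    linarith
  have hsub : {x : EuclideanSpace ℝ (Fin D) | ‖x‖ ≤ 1 ∧ c * ‖x‖ ≤ inner ℝ e x} ⊆
      Metric.closedBall (c • e) s ∪ T ⁻¹' Metric.closedBall (-e) 1 := by
    rintro x ⟨hx1, hx2⟩
    have hw0 : 0 ≤ inner ℝ e x := (by positivity : 0 ≤ c * ‖x‖).trans hx2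
    rcases le_total c (inner ℝ e x) with h | h
    · left
      rw [mem_closedBall_iff_norm]
      refine abs_le_of_sq_le_sq' ?_ hs.le |>.2
      rw [norm_sub_sq_real, norm_smul, he, inner_smul_right, real_inner_comm,
        Real.norm_of_nonneg hc.le]
      nlinarith [norm_nonneg x]
    · right
      rw [Set.mem_preimage, mem_closedBall_iff_norm, sub_neg_eq_add]
      refine abs_le_of_sq_le_sq' ?_ zero_le_one |>.2
      obtain ⟨w, hw⟩ : ∃ w, w = inner ℝ e x / c := ⟨_, rfl⟩
      have hwx : inner ℝ e x = c * w := by rw [hw]; field_simp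
      have hwn : 0 ≤ w := by rw [hw]; positivity
      have hw1 : w ≤ 1 := by rw [hw]; exact (div_le_one hc).2 h
      have hxw : ‖x‖ ≤ w := by
        rw [hwx] at hx2; exact le_of_mul_le_mul_left hx2 hc
      have hTe : T x + e = s⁻¹ • x + (1 - w - s⁻¹ * (c * w)) • e := by
        rw [hTx, hwx]
        simp only [smul_add, smul_smul, add_assoc]
        congr 1
        nth_rewrite 2 [← one_smul ℝ e]
        rw [← add_smul]
        congr 1
        field_simp
        ring
      have hnorm : ‖T x + e‖ ^ 2 = (1 - w) ^ 2 + (s⁻¹) ^ 2 * (‖x‖ ^ 2 - (c * w) ^ 2) := by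
        rw [hTe, norm_add_sq_real, norm_smul, norm_smul, he, inner_smul_left, inner_smul_right,
          real_inner_comm, hwx]
        simp only [mul_pow, mul_one, Real.norm_eq_abs, sq_abs, RCLike.conj_to_real]
        ring
      have hq : (s⁻¹) ^ 2 * (‖x‖ ^ 2 - (c * w) ^ 2) ≤ w ^ 2 := by
        rw [inv_pow, inv_mul_le_iff₀ (by positivity)]
        nlinarith [norm_nonneg x]
      -- What remains is `(1 - w)² + w² ≤ 1` on `[0, 1]`.
      rw [hnorm]
      nlinarith
  calc volume {x : EuclideanSpace ℝ (Fin D) | ‖x‖ ≤ 1 ∧ c * ‖x‖ ≤ inner ℝ e x}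
      ≤ volume (Metric.closedBall (c • e) s) + volume (T ⁻¹' Metric.closedBall (-e) 1) :=
        (measure_mono hsub).trans (measure_union_le _ _)
    _ = ENNReal.ofReal (s ^ D + c * s ^ (D - 1)) *
          volume (Metric.ball (0 : EuclideanSpace ℝ (Fin D)) 1) := by
        rw [Measure.addHaar_preimage_linearMap _ hdet0, hdet, abs_neg,
          abs_of_nonneg (by positivity), Measure.addHaar_closedBall _ _ hs.le,
          Measure.addHaar_closedBall _ _ zero_le_one, finrank_euclideanSpace, Fintype.card_fin,
          one_pow, ENNReal.ofReal_one, one_mul, ENNReal.ofReal_add (by positivity) (by positivity),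
          add_mul]
    _ ≤ _ := by
        gcongr
        have h1 : s ≤ 1 := by nlinarith
        have h2 : c ≤ 1 := by nlinarith
        have h3 : s ^ D = s * s ^ (D - 1) := by
          rw [← pow_succ', Nat.sub_add_cancel hD]
        have h4 : 0 < s ^ (D - 1) := by positivity
        rw [h3]
        nlinarith

lemma measurable_smul_sphere {D : ℕ} (M : ℝ) :
    Measurable (fun u : Metric.sphere (0 : EuclideanSpace ℝ (Fin D)) 1 =>
      M • (u : EuclideanSpace ℝ (Fin D))) :=
  (continuous_subtype_val.const_smul M).measurable

lemma uniformSphere_norm_ne {D : ℕ} {M : ℝ} (hM : 0 < M) :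
    uniformSphere D M {y | ‖y‖ ≠ M} = 0 := by
  have hmeas : MeasurableSet {y : EuclideanSpace ℝ (Fin D) | ‖y‖ ≠ M} :=
    (measurableSet_eq_fun measurable_norm measurable_const).compl
  rw [uniformSphere, Measure.map_apply (measurable_smul_sphere M) hmeas]
  have : (fun u : Metric.sphere (0 : EuclideanSpace ℝ (Fin D)) 1 =>
      M • (u : EuclideanSpace ℝ (Fin D))) ⁻¹' {y | ‖y‖ ≠ M} = ∅ := by
    ext u
    simp [norm_smul, abs_of_pos hM]
  rw [this, measure_empty]

open scoped Pointwise in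
-- The surface measure of a set is `D` times the volume of the cone over it, so the normalized
-- measure is a ratio of cone to ball, bounded by `volume_cone_le`.
lemma uniformSphere_cap_le {D : ℕ} (hD : 1 ≤ D) {M : ℝ} (hM : 0 < M)
    {a : EuclideanSpace ℝ (Fin D)} (ha : ‖a‖ = M) {s c : ℝ} (hs : 0 < s) (hc : 0 < c)
    (hsc : s ^ 2 + c ^ 2 = 1) :
    uniformSphere D M {y | M ^ 2 * c < inner ℝ a y} ≤ ENNReal.ofReal (2 * s ^ (D - 1)) := by
  have hmeas : MeasurableSet {y : EuclideanSpace ℝ (Fin D) | M ^ 2 * c < inner ℝ a y} :=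
    measurableSet_lt measurable_const (by fun_prop)
  have hdim : (D : ENNReal) ≠ 0 := by
    simpa using (by omega : D ≠ 0)
  set e : EuclideanSpace ℝ (Fin D) := M⁻¹ • a with he_def
  have he : ‖e‖ = 1 := by
    rw [he_def, norm_smul, ha, norm_inv, Real.norm_of_nonneg hM.le, inv_mul_cancel₀ hM.ne']
  have hae : a = M • e := by rw [he_def, smul_smul, mul_inv_cancel₀ hM.ne', one_smul]
  have hb0 : volume (Metric.ball (0 : EuclideanSpace ℝ (Fin D)) 1) ≠ 0 :=
    (Metric.measure_ball_pos _ _ one_pos).ne'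
  have hbt : volume (Metric.ball (0 : EuclideanSpace ℝ (Fin D)) 1) ≠ ⊤ :=
    measure_ball_lt_top.ne
  rw [uniformSphere, Measure.map_apply (measurable_smul_sphere M) hmeas, Measure.smul_apply,
    smul_eq_mul, Measure.toSphere_apply_univ,
    Measure.toSphere_apply' _ (measurable_smul_sphere M hmeas), finrank_euclideanSpace,
    Fintype.card_fin]
  have hsub : Set.Ioo (0 : ℝ) 1 • ((↑) '' ((fun u : Metric.sphere (0 : EuclideanSpace ℝ (Fin D)) 1
      => M • (u : EuclideanSpace ℝ (Fin D))) ⁻¹' {y | M ^ 2 * c < inner ℝ a y})) ⊆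
      {x : EuclideanSpace ℝ (Fin D) | ‖x‖ ≤ 1 ∧ c * ‖x‖ ≤ inner ℝ e x} := by
    rintro _ ⟨r, hr, _, ⟨u, hu, rfl⟩, rfl⟩
    have hun : ‖(u : EuclideanSpace ℝ (Fin D))‖ = 1 := by simp
    simp only [Set.mem_preimage, Set.mem_ofPred_eq] at hu
    rw [hae, inner_smul_left, inner_smul_right, RCLike.conj_to_real, ← mul_assoc, ← sq] at hu
    have hu' := lt_of_mul_lt_mul_left hu (by positivity)
    have hr0 : 0 < r := hr.1
    change ‖r • (u : EuclideanSpace ℝ (Fin D))‖ ≤ 1 ∧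
      c * ‖r • (u : EuclideanSpace ℝ (Fin D))‖ ≤ inner ℝ e (r • (u : EuclideanSpace ℝ (Fin D)))
    rw [norm_smul, hun, inner_smul_right, mul_one, Real.norm_of_nonneg hr0.le]
    exact ⟨hr.2.le, by nlinarith⟩
  calc _ ≤ ((D : ENNReal) * volume (Metric.ball (0 : EuclideanSpace ℝ (Fin D)) 1))⁻¹ *
        (D * (ENNReal.ofReal (2 * s ^ (D - 1)) *
          volume (Metric.ball (0 : EuclideanSpace ℝ (Fin D)) 1))) := by
        gcongr
        exact (measure_mono hsub).trans (volume_cone_le hD he hs hc hsc)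
    _ = ((D : ENNReal) * volume (Metric.ball (0 : EuclideanSpace ℝ (Fin D)) 1))⁻¹ *
        (D * volume (Metric.ball (0 : EuclideanSpace ℝ (Fin D)) 1)) *
          ENNReal.ofReal (2 * s ^ (D - 1)) := by ring
    _ = ENNReal.ofReal (2 * s ^ (D - 1)) := by
        rw [ENNReal.inv_mul_cancel (mul_ne_zero hdim hb0)
          (ENNReal.mul_ne_top (ENNReal.natCast_ne_top D) hbt), one_mul]

/-- Two independent uniform points on a sphere are unlikely to be close to each other. -/
lemma measure_inner_gt_le {D : ℕ} (hD : 1 ≤ D) {M : ℝ} (hM : 0 < M) {s c : ℝ} (hs : 0 < s)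
    (hc : 0 < c) (hsc : s ^ 2 + c ^ 2 = 1) {S : Type*} [MeasurableSpace S] {P : Measure S}
    [IsProbabilityMeasure P] {Y Z : S → EuclideanSpace ℝ (Fin D)} (hYZ : IndepFun Y Z P)
    (hY : HasLaw Y (uniformSphere D M) P) (hZ : HasLaw Z (uniformSphere D M) P) :
    P {ω | M ^ 2 * c < inner ℝ (Y ω) (Z ω)} ≤ ENNReal.ofReal (2 * s ^ (D - 1)) := by
  have hprob : IsProbabilityMeasure (uniformSphere D M) := by
    rw [← hY.map_eq]; exact Measure.isProbabilityMeasure_map hY.aemeasurable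
  have hmeas : MeasurableSet {z : EuclideanSpace ℝ (Fin D) × EuclideanSpace ℝ (Fin D) |
      M ^ 2 * c < inner ℝ z.1 z.2} :=
    measurableSet_lt measurable_const (by fun_prop)
  have hmap := hYZ.map_prod_eq_prod_map_map hY.aemeasurable hZ.aemeasurable
  rw [hY.map_eq, hZ.map_eq] at hmap
  have h1 : P {ω | M ^ 2 * c < inner ℝ (Y ω) (Z ω)} =
      (uniformSphere D M).prod (uniformSphere D M) {z | M ^ 2 * c < inner ℝ z.1 z.2} := by
    rw [← hmap, Measure.map_apply_of_aemeasurable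
      (hY.aemeasurable.prodMk hZ.aemeasurable) hmeas]
    rfl
  -- Fubini: with the first point fixed, almost surely of norm `M`, the event is a cap.
  rw [h1, Measure.prod_apply hmeas]
  have hae : ∀ᵐ a ∂uniformSphere D M, ‖a‖ = M := by
    rw [ae_iff]; exact uniformSphere_norm_ne hM
  calc _ ≤ ∫⁻ _, ENNReal.ofReal (2 * s ^ (D - 1)) ∂uniformSphere D M := by
        refine lintegral_mono_ae ?_
        filter_upwards [hae] with a ha
        exact uniformSphere_cap_le hD hM ha hs hc hsc
    _ = _ := by simp

/-! ### Random patterns: union bound -/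

/-- The capacity bound leaves room for two patterns only if `1 < ζ`. -/
lemma one_lt_of_two_le_capacity {D N : ℕ} {p ζ : ℝ} (hD : 1 ≤ D) (hp : p ≤ 1)
    (hζ : 0 < ζ) (hN : (N : ℝ) ≤ 1 / 2 * (√p * ζ ^ (((D : ℝ) - 1) / 2))) (h2 : 2 ≤ N) :
    1 < ζ := by
  by_contra! h
  have hD' : (1 : ℝ) ≤ D := by exact_mod_cast hD
  have h1 : ζ ^ (((D : ℝ) - 1) / 2) ≤ 1 := Real.rpow_le_one hζ.le h (by linarith)
  have h0 : 0 ≤ ζ ^ (((D : ℝ) - 1) / 2) := by positivity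
  have h3 : √p ≤ 1 := Real.sqrt_le_one.2 hp
  have h4 : √p * ζ ^ (((D : ℝ) - 1) / 2) ≤ 1 := mul_le_one₀ h3 h0 h1
  have h5 : (2 : ℝ) ≤ N := by exact_mod_cast h2
  linarith

/-- Since `|sin (1/ζ)| ≤ 1/ζ`, the powers of `ζ` cancel; the constant `1/2` leaves `p / 2`. -/
lemma sq_mul_cap_le {D N : ℕ} {p ζ : ℝ} (hD : 1 ≤ D) (hp0 : 0 ≤ p)
    (hζ : 0 < ζ) (hN : (N : ℝ) ≤ 1 / 2 * (√p * ζ ^ (((D : ℝ) - 1) / 2))) :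
    (N : ℝ) ^ 2 * (2 * Real.sin (1 / ζ) ^ (D - 1)) ≤ p := by
  have hpow : (ζ ^ (((D : ℝ) - 1) / 2)) ^ 2 = ζ ^ (D - 1) := by
    rw [← Real.rpow_natCast, ← Real.rpow_mul hζ.le, ← Real.rpow_natCast ζ (D - 1)]
    congr 1
    push_cast [Nat.cast_sub hD]
    ring
  have h1 : (N : ℝ) ^ 2 ≤ 1 / 4 * (p * ζ ^ (D - 1)) := by
    calc (N : ℝ) ^ 2 ≤ (1 / 2 * (√p * ζ ^ (((D : ℝ) - 1) / 2))) ^ 2 := by gcongr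
      _ = _ := by rw [mul_pow, mul_pow, hpow, Real.sq_sqrt hp0]; norm_num
  have h2 : Real.sin (1 / ζ) ^ (D - 1) ≤ (1 / ζ) ^ (D - 1) := by
    refine (le_abs_self _).trans ?_
    rw [abs_pow]
    gcongr
    exact (Real.abs_sin_le_abs).trans_eq (abs_of_pos (by positivity))
  have h3 : ζ ^ (D - 1) * (1 / ζ) ^ (D - 1) = 1 := by
    rw [← mul_pow, mul_one_div_cancel hζ.ne', one_pow]
  calc (N : ℝ) ^ 2 * (2 * Real.sin (1 / ζ) ^ (D - 1))
      ≤ (N : ℝ) ^ 2 * (2 * (1 / ζ) ^ (D - 1)) := by gcongr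
    _ ≤ 1 / 4 * (p * ζ ^ (D - 1)) * (2 * (1 / ζ) ^ (D - 1)) := by gcongr
    _ = p / 2 * (ζ ^ (D - 1) * (1 / ζ) ^ (D - 1)) := by ring
    _ ≤ p := by rw [h3]; linarith

lemma measure_not_storesInOneIteration_le {D N : ℕ} {M β m ε p ζ : ℝ} {Ω : (Fin N → ℝ) → ℝ}
    (hD : 1 ≤ D) (hM : 0 < M) (hβ : 0 < β) (hp0 : 0 ≤ p) (hp1 : p ≤ 1) (hζ : 0 < ζ)
    (hΩ : IsGeneralizedNegentropy Ω) (hm : HasMargin Ω m)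
    (hε : ε ≤ M / 2 * (1 - Real.cos (1 / ζ)) - m / (2 * β * M))
    (hN : (N : ℝ) ≤ 1 / 2 * (√p * ζ ^ (((D : ℝ) - 1) / 2)))
    {S : Type*} [MeasurableSpace S] {P : Measure S} [IsProbabilityMeasure P]
    {X : Fin N → S → EuclideanSpace ℝ (Fin D)} (hX : iIndepFun X P)
    (hlaw : ∀ i, HasLaw (X i) (uniformSphere D M) P) :
    P {ω | ¬ StoresInOneIteration Ω β ε (fun i => X i ω)} ≤ ENNReal.ofReal p := by
  -- Two distinct indices force `1/ζ < 1`, an acute angle as the cap bound needs; with fewer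
  -- patterns there are no pairs to estimate.
  have hζ1 : ∀ i j : Fin N, i ≠ j → 1 < ζ := fun i j hij =>
    one_lt_of_two_le_capacity hD hp1 hζ hN (by have := Fin.val_ne_of_ne hij; omega)
  have htrig : 1 < ζ → 0 < Real.sin (1 / ζ) ∧ 0 < Real.cos (1 / ζ) ∧ Real.cos (1 / ζ) < 1 := by
    intro h
    have ha : 0 < 1 / ζ := by positivity
    have hb : 1 / ζ < 1 := (div_lt_one hζ).2 h
    refine ⟨Real.sin_pos_of_pos_of_lt_pi ha (by linarith [Real.pi_gt_three]),
      Real.cos_pos_of_mem_Ioo ⟨by linarith [Real.pi_gt_three], by linarith [Real.pi_gt_three]⟩, ?_⟩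
    exact (Real.cos_lt_cos_of_nonneg_of_le_pi le_rfl (by linarith [Real.pi_gt_three])
      ha).trans_eq Real.cos_zero
  have hnorm : ∀ᵐ ω ∂P, ∀ i, ‖X i ω‖ = M := by
    rw [ae_all_iff]
    intro i
    rw [ae_iff, (hlaw i).measure_eq (p := fun y => ¬ ‖y‖ = M)
      (measurableSet_eq_fun measurable_norm measurable_const).compl]
    exact uniformSphere_norm_ne hM
  have hle : {ω | ¬ StoresInOneIteration Ω β ε (fun i => X i ω)} ≤ᵐ[P]
      ⋃ z ∈ (Finset.univ : Finset (Fin N)).offDiag,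
        {ω | M ^ 2 * Real.cos (1 / ζ) < inner ℝ (X z.1 ω) (X z.2 ω)} := by
    filter_upwards [hnorm] with ω hω hbad
    by_contra hcon
    refine hbad ?_
    have hinner : ∀ i j, i ≠ j → inner ℝ (X i ω) (X j ω) ≤ M ^ 2 * Real.cos (1 / ζ) := by
      intro i j hij
      by_contra! h
      exact hcon (Set.mem_biUnion (x := (i, j)) (by simpa using hij) h)
    -- Coinciding patterns would have cosine `1 > cos (1/ζ)`, so distinctness needs no separate
    -- event.
    refine storesInOneIteration_of_inner_le hM hβ hΩ hm (fun i j hij => ?_) hω hinner hε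
    by_contra hne
    have h1 := hinner i j hne
    have h2 := (htrig (hζ1 i j hne)).2.2
    have hij' : X i ω = X j ω := hij
    rw [hij', real_inner_self_eq_norm_sq, hω] at h1
    nlinarith [pow_pos hM 2]
  calc P {ω | ¬ StoresInOneIteration Ω β ε (fun i => X i ω)}
      ≤ ∑ z ∈ (Finset.univ : Finset (Fin N)).offDiag,
          P {ω | M ^ 2 * Real.cos (1 / ζ) < inner ℝ (X z.1 ω) (X z.2 ω)} :=
        (measure_mono_ae hle).trans (measure_biUnion_finset_le _ _)
    _ ≤ ∑ _z ∈ (Finset.univ : Finset (Fin N)).offDiag,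
          ENNReal.ofReal (2 * Real.sin (1 / ζ) ^ (D - 1)) := by
        refine Finset.sum_le_sum fun z hz => ?_
        have hne : z.1 ≠ z.2 := (Finset.mem_offDiag.1 hz).2.2
        obtain ⟨hs, hc, -⟩ := htrig (hζ1 _ _ hne)
        exact measure_inner_gt_le hD hM hs hc (Real.sin_sq_add_cos_sq _) (hX.indepFun hne)
          (hlaw _) (hlaw _)
    _ ≤ (N ^ 2 : ℕ) * ENNReal.ofReal (2 * Real.sin (1 / ζ) ^ (D - 1)) := by
        rw [Finset.sum_const, nsmul_eq_mul]
        gcongr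
        rw [Finset.offDiag_card, Finset.card_univ, Fintype.card_fin, sq]
        omega
    _ ≤ ENNReal.ofReal p := by
        rw [← ENNReal.ofReal_natCast, ← ENNReal.ofReal_mul (by positivity)]
        push_cast
        exact ENNReal.ofReal_le_ofReal (sq_mul_cap_le hD hp0 hζ hN)

end HFY

theorem proposition3 :
    -- patterns on the sphere of radius `M` with pairwise angles at least `π / 3`
    ((∀ (D N : ℕ) (M β m ε : ℝ) (Ω : (Fin N → ℝ) → ℝ) (x : Fin N → EuclideanSpace ℝ (Fin D)),
        0 < M → 0 < β →
        HFY.IsGeneralizedNegentropy Ω → HFY.HasMargin Ω m →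
        2 * m * β⁻¹ < M ^ 2 → ε ≤ M / 4 - m / (2 * β * M) →
        HFY.IsSeparatedOnSphere M (Real.pi / 3) x →
        HFY.StoresInOneIteration Ω β ε x) ∧
      ∃ c : ℝ, 0 < c ∧ ∀ D : ℕ, 1 ≤ D → ∀ M : ℝ, 0 < M →
        ∃ (N : ℕ) (x : Fin N → EuclideanSpace ℝ (Fin D)),
          c * (2 / √3) ^ D ≤ (N : ℝ) ∧ HFY.IsSeparatedOnSphere M (Real.pi / 3) x) ∧
    -- independent patterns, uniformly distributed on the sphere of radius `M`;
    -- the failure event has (outer) probability at most `p`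
    ∃ c : ℝ, 0 < c ∧
      ∀ (D N : ℕ) (M β m ε p ζ : ℝ) (Ω : (Fin N → ℝ) → ℝ),
        1 ≤ D → 0 < M → 0 < β → 0 ≤ p → p ≤ 1 → 0 < ζ →
        HFY.IsGeneralizedNegentropy Ω → HFY.HasMargin Ω m →
        ε ≤ M / 2 * (1 - Real.cos (1 / ζ)) - m / (2 * β * M) →
        (N : ℝ) ≤ c * (√p * ζ ^ (((D : ℝ) - 1) / 2)) →
        ∀ (S : Type*) [MeasurableSpace S] (P : Measure S) [IsProbabilityMeasure P]
          (X : Fin N → S → EuclideanSpace ℝ (Fin D)),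
          iIndepFun X P → (∀ i, HasLaw (X i) (HFY.uniformSphere D M) P) →
          P {ω | ¬ HFY.StoresInOneIteration Ω β ε (fun i => X i ω)} ≤ ENNReal.ofReal p := by
  refine ⟨⟨?_, 1, one_pos, fun D hD M hM => ?_⟩, 1 / 2, by norm_num, ?_⟩
  · intro D N M β m ε Ω x hM hβ hΩ hm _ hε hx
    have hpi : 0 < Real.pi / 3 := by positivity
    refine HFY.storesInOneIteration_of_inner_le hM hβ hΩ hm (hx.injective hM hpi) hx.1
      (fun i j hij => hx.inner_le hpi.le hij) (hε.trans_eq ?_)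
    rw [Real.cos_pi_div_three]
    ring
  · simpa using HFY.exists_isSeparatedOnSphere hD hM
  · intro D N M β m ε p ζ Ω hD hM hβ hp0 hp1 hζ hΩ hm hε hN S _ P _ X hX hlaw
    exact HFY.measure_not_storesInOneIteration_le hD hM hβ hp0 hp1 hζ hΩ hm hε hN hX hlaw
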